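/- Let $K$ be a field of characteristic zero, $n\ge 0$, and let $q_1,\dots,q_n\in K\setminus\{0\}$. Let $Q_n$ be the $n$-th $\underline q$-Weyl algebra, i.e. the $K$-algebra generated by $x_1,\dots,x_n,\partial_1,\dots,\partial_n$ with relations $x_ix_j=x_jx_i$, $\partial_i\partial_j=\partial_j\partial_i$ for all $i,j$, $\partial_ix_j=x_j\partial_i$ for $i\ne j$, and $\partial_ix_i=q_ix_i\partial_i+1$; for $q_1=\dots=q_n=1$ it is the Weyl algebra $A_n$. Put $\theta_i=x_i\partial_i$, and let $K[\theta]=K[\theta_1,\dots,\theta_n]\subseteq Q_n$ be the (commutative) subalgebra generated by $\theta_1,\dots,\theta_n$. Fix a monomial order on the commutative monomials in $\theta_1,\dots,\theta_n$; an element of $K[\theta]$ is monic if it is the value at $\theta_1,\dots,\theta_n$ of a polynomial with leading coefficient $1$. An element of a ring is reducible if it is nonzero, not a unit, and a product of two nonunits. 1. The monic irreducible elements of $K[\theta]$ that are reducible in $Q_n$ are exactly the elements $\theta_i$ and $\theta_i+\frac1{q_i}$, $1\le i\le n$. In particular, in $A_n$ they are exactly the elements $\theta_i$ and $\theta_i+1$,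 $1\le i\le n$. 2. One has $\theta_i=x_i\cdot\partial_i$ and $\theta_i+\frac1{q_i}=\frac1{q_i}\,\partial_i\cdot x_i$ in $Q_n$; in $A_n$ the latter reads $\theta_i+1=\partial_i\cdot x_i$. 3. Let $p\in Q_n$ be homogeneous of degree $0$, i.e. a $K$-linear combination of monomials $x_1^{a_1}\cdots x_n^{a_n}\partial_1^{a_1}\cdots\partial_n^{a_n}$. Then $p\in K[\theta]$, and if $p\ne0$ then $p=c\,f_1\cdots f_r$ with $c\in K\setminus\{0\}$, $r \ge 0$ and monic irreducible elements $f_1,\dots,f_r$ of $K[\theta]$. For every such commutative factorization, replacing each factor $f_k=\theta_i$ by the two factors $x_i,\partial_i$, and each factor $f_k=\theta_i+\frac1{q_i}$ by the two factors $\partial_i,x_i$ while multiplying the constant $c$ by $\frac1{q_i}$, yields a factorization of $p$ in $Q_n$ all of whose non-constant factors are irreducible in $Q_n$. In $A_n$ the same holds with $\theta_i+1=\partial_i\cdot x_i$ in place of $\theta_i+\frac1{q_i}$ and with the constant $c$ unchanged. -/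

import Mathlib

/-- The defining relations of the `n`-th `q`-Weyl algebra, on the free algebra with generators
`x i = ι (inl i)` and `∂ i = ι (inr i)`. -/
inductive QWeylRel {K : Type*} [Field K] {n : ℕ} (q : Fin n → Kˣ) :
    FreeAlgebra K (Fin n ⊕ Fin n) → FreeAlgebra K (Fin n ⊕ Fin n) → Prop
  | x_comm (i j : Fin n) : QWeylRel q
      (FreeAlgebra.ι K (Sum.inl i) * FreeAlgebra.ι K (Sum.inl j))
      (FreeAlgebra.ι K (Sum.inl j) * FreeAlgebra.ι K (Sum.inl i))
  | d_comm (i j : Fin n) : QWeylRel q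
      (FreeAlgebra.ι K (Sum.inr i) * FreeAlgebra.ι K (Sum.inr j))
      (FreeAlgebra.ι K (Sum.inr j) * FreeAlgebra.ι K (Sum.inr i))
  | d_x_ne (i j : Fin n) (h : i ≠ j) : QWeylRel q
      (FreeAlgebra.ι K (Sum.inr i) * FreeAlgebra.ι K (Sum.inl j))
      (FreeAlgebra.ι K (Sum.inl j) * FreeAlgebra.ι K (Sum.inr i))
  | d_x (i : Fin n) : QWeylRel q
      (FreeAlgebra.ι K (Sum.inr i) * FreeAlgebra.ι K (Sum.inl i))
      ((q i : K) • (FreeAlgebra.ι K (Sum.inl i) * FreeAlgebra.ι K (Sum.inr i)) + 1)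

/-- The `n`-th `q`-Weyl algebra `Q_n` over `K`, with parameters `q_1, …, q_n ∈ Kˣ`. -/
abbrev QWeylAlgebra {K : Type*} [Field K] {n : ℕ} (q : Fin n → Kˣ) : Type _ :=
  RingQuot (QWeylRel q)

namespace QWeylAlgebra

/-- The generator `x_i`. -/
noncomputable def x {K : Type*} [Field K] {n : ℕ} (q : Fin n → Kˣ) (i : Fin n) :
    QWeylAlgebra q :=
  RingQuot.mkAlgHom K (QWeylRel q) (FreeAlgebra.ι K (Sum.inl i))

/-- The generator `∂_i`. -/
noncomputable def d {K : Type*} [Field K] {n : ℕ} (q : Fin n → Kˣ) (i : Fin n) :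
    QWeylAlgebra q :=
  RingQuot.mkAlgHom K (QWeylRel q) (FreeAlgebra.ι K (Sum.inr i))

/-- The Euler operator `θ_i = x_i ∂_i`. -/
noncomputable def theta {K : Type*} [Field K] {n : ℕ} (q : Fin n → Kˣ) (i : Fin n) :
    QWeylAlgebra q :=
  x q i * d q i

/-- The monomial `X^a D^b = x_1^{a_1} ⋯ x_n^{a_n} ∂_1^{b_1} ⋯ ∂_n^{b_n}`. -/
noncomputable def xdMonomial {K : Type*} [Field K] {n : ℕ} (q : Fin n → Kˣ) (a b : Fin n → ℕ) :
    QWeylAlgebra q :=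
  (List.ofFn fun i => x q i ^ a i).prod * (List.ofFn fun i => d q i ^ b i).prod

/-- The `z`-th graded part of `Q_n`, `z ∈ ℤⁿ`: the `K`-span of the monomials `X^a D^b` with
`b - a = z`. -/
noncomputable def gradedPart {K : Type*} [Field K] {n : ℕ} (q : Fin n → Kˣ) (z : Fin n → ℤ) :
    Submodule K (QWeylAlgebra q) :=
  Submodule.span K {p | ∃ a b : Fin n → ℕ, (∀ i, (b i : ℤ) - (a i : ℤ) = z i) ∧
    p = xdMonomial q a b}

/-- The subalgebra `K[θ_1, …, θ_n]` of `Q_n`. -/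
abbrev thetaAlgebra {K : Type*} [Field K] {n : ℕ} (q : Fin n → Kˣ) :
    Subalgebra K (QWeylAlgebra q) :=
  Algebra.adjoin K (Set.range (theta q))

theorem x_mul_x {K : Type*} [Field K] {n : ℕ} (q : Fin n → Kˣ) (i j : Fin n) :
    x q i * x q j = x q j * x q i := by
  simpa [x] using RingQuot.mkAlgHom_rel K (QWeylRel.x_comm (q := q) i j)

theorem d_mul_d {K : Type*} [Field K] {n : ℕ} (q : Fin n → Kˣ) (i j : Fin n) :
    d q i * d q j = d q j * d q i := by
  simpa [d] using RingQuot.mkAlgHom_rel K (QWeylRel.d_comm (q := q) i j)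

theorem d_mul_x_of_ne {K : Type*} [Field K] {n : ℕ} (q : Fin n → Kˣ) {i j : Fin n} (h : i ≠ j) :
    d q i * x q j = x q j * d q i := by
  simpa [x, d] using RingQuot.mkAlgHom_rel K (QWeylRel.d_x_ne (q := q) i j h)

theorem theta_mul_theta {K : Type*} [Field K] {n : ℕ} (q : Fin n → Kˣ) (i j : Fin n) :
    theta q i * theta q j = theta q j * theta q i := by
  rcases eq_or_ne i j with rfl | h
  · rfl
  · unfold theta
    calc x q i * d q i * (x q j * d q j)
        = x q i * (d q i * x q j) * d q j := by simp only [mul_assoc]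
      _ = (x q i * x q j) * (d q i * d q j) := by
        rw [d_mul_x_of_ne q h]; simp only [mul_assoc]
      _ = (x q j * x q i) * (d q j * d q i) := by rw [x_mul_x q i j, d_mul_d q i j]
      _ = x q j * (x q i * d q j) * d q i := by simp only [mul_assoc]
      _ = x q j * d q j * (x q i * d q i) := by
        rw [← d_mul_x_of_ne q h.symm]; simp only [mul_assoc]

/-- `K[θ_1, …, θ_n]` is a commutative ring. -/
noncomputable instance instCommRingThetaAlgebra {K : Type*} [Field K] {n : ℕ} (q : Fin n → Kˣ) :
    CommRing (thetaAlgebra q) :=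
  { (inferInstance : Ring (thetaAlgebra q)) with
    mul_comm := (Algebra.isMulCommutative_adjoin K (by
      rintro _ ⟨i, rfl⟩ _ ⟨j, rfl⟩
      exact theta_mul_theta q i j)).is_comm.comm }

/-- `θ_i` as an element of `K[θ_1, …, θ_n]`. -/
noncomputable def thetaGen {K : Type*} [Field K] {n : ℕ} (q : Fin n → Kˣ) (i : Fin n) :
    thetaAlgebra q :=
  ⟨theta q i, Algebra.subset_adjoin ⟨i, rfl⟩⟩

/-- `θ_i + 1/q_i` as an element of `K[θ_1, …, θ_n]`. -/
noncomputable def thetaShift {K : Type*} [Field K] {n : ℕ} (q : Fin n → Kˣ) (i : Fin n) :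
    thetaAlgebra q :=
  thetaGen q i + algebraMap K (thetaAlgebra q) (1 / (q i : K))

/-- `f ∈ K[θ_1, …, θ_n]` is monic with respect to the monomial order `m`: it is the value at
`θ_1, …, θ_n` of a commutative polynomial whose leading coefficient with respect to `m` is `1`. -/
def IsThetaMonic {K : Type*} [Field K] {n : ℕ} (q : Fin n → Kˣ) (m : MonomialOrder (Fin n))
    (f : thetaAlgebra q) : Prop :=
  ∃ P : MvPolynomial (Fin n) K, m.Monic P ∧ MvPolynomial.aeval (thetaGen q) P = f

/-- An element of a ring is reducible if it is nonzero, not a unit, and a product of two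
nonunits. -/
def IsReducible {R : Type*} [Ring R] (f : R) : Prop :=
  f ≠ 0 ∧ ¬ IsUnit f ∧ ∃ g h : R, ¬ IsUnit g ∧ ¬ IsUnit h ∧ f = g * h

/-- `p = c · f_1 ⋯ f_r` is a complete commutative factorization of `p` in `K[θ_1, …, θ_n]`:
`c ∈ K` is nonzero and `f_1, …, f_r` are monic irreducible elements of `K[θ_1, …, θ_n]`. -/
def IsThetaFactorization {K : Type*} [Field K] {n : ℕ} (q : Fin n → Kˣ)
    (m : MonomialOrder (Fin n)) (p : QWeylAlgebra q) (c : K) (L : List (thetaAlgebra q)) : Prop :=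
  c ≠ 0 ∧ (∀ f ∈ L, IsThetaMonic q m f ∧ Irreducible f) ∧
    p = c • ((L.prod : thetaAlgebra q) : QWeylAlgebra q)

open Classical in
/-- The list of factors in `Q_n` that replaces the factor `f ∈ K[θ_1, …, θ_n]`: `x_i, ∂_i` if
`f = θ_i`; `∂_i, x_i` if `f = θ_i + 1/q_i`; and `f` itself otherwise. -/
noncomputable def rewriteFactor {K : Type*} [Field K] {n : ℕ} (q : Fin n → Kˣ)
    (f : thetaAlgebra q) : List (QWeylAlgebra q) :=
  if h : ∃ i, f = thetaGen q i then [x q h.choose, d q h.choose]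
  else if h : ∃ i, f = thetaShift q i then [d q h.choose, x q h.choose]
  else [(f : QWeylAlgebra q)]

open Classical in
/-- The scalar that appears when `f` is replaced by the product of `rewriteFactor q f`: it is
`1/q_i` if `f = θ_i + 1/q_i = (1/q_i) ∂_i x_i`, and `1` otherwise. -/
noncomputable def rewriteScalar {K : Type*} [Field K] {n : ℕ} (q : Fin n → Kˣ)
    (f : thetaAlgebra q) : K :=
  if ∃ i, f = thetaGen q i then 1
  else if h : ∃ i, f = thetaShift q i then 1 / (q h.choose : K)
  else 1

end QWeylAlgebra

/-- The `n`-th Weyl algebra `A_n` over `K`: the case `q_1 = ⋯ = q_n = 1` of `Q_n`. -/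
abbrev weylParam (K : Type*) [Field K] (n : ℕ) : Fin n → Kˣ := fun _ => 1

/-!
`Q_n` maps to the skew group algebra of `ℤⁿ` over `K[θ]` by `∂_i ↦ t_i`, `x_i ↦ θ_i t_i⁻¹`. As
`ℤⁿ` has unique products, every factor of a homogeneous element is homogeneous, and the total degree
in the generators is additive on homogeneous elements and vanishes exactly on units; hence elements
of degree `1`, in particular the generators, are irreducible. Let `f ∈ K[θ]` be irreducible and
`f = g h` with nonunits `g` and `h`, of multidegrees `z` and `-z`. Then `z ≠ 0`, so
`g = F(θ) s r` for a generator `s`, where `r h` is homogeneous of the multidegree opposite to that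
of `s`, i.e. `r h = G(θ) s'` with `s s' = θ_i` or `s s' = q_i θ_i + 1`. Moving `s` past `G(θ)` makes
`f` a multiple of `s s'` in `K[θ]`, and by irreducibility a scalar multiple.
-/

theorem mul_prod_ofFn {M : Type*} [Monoid M] {n : ℕ} (f : Fin n → M) (a : M) (i : Fin n)
    (h : ∀ j < i, Commute a (f j)) :
    a * (List.ofFn f).prod = (List.ofFn (Function.update f i (a * f i))).prod := by
  induction n with
  | zero => exact i.elim0
  | succ n ih =>
    simp only [List.ofFn_succ, List.prod_cons]
    cases i using Fin.cases with
    | zero => simp [mul_assoc]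
    | succ i =>
      have tail : (fun j : Fin n => Function.update f i.succ (a * f i.succ) j.succ) =
          Function.update (fun j => f j.succ) i (a * f i.succ) :=
        Function.update_comp_eq_of_injective f (Fin.succ_injective n) i _
      rw [tail, Function.update_of_ne (Fin.succ_ne_zero i).symm, ← mul_assoc,
        (h 0 i.succ_pos).eq, mul_assoc,
        ih (fun j => f j.succ) i fun j hj => h j.succ (Fin.succ_lt_succ_iff.2 hj)]

section MvPolynomial

open MvPolynomial

theorem totalDegree_aeval_le {R σ τ : Type*} [CommSemiring R] (f : σ → MvPolynomial τ R)
    (hf : ∀ s, (f s).totalDegree ≤ 1) (P : MvPolynomial σ R) :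
    (aeval f P).totalDegree ≤ P.totalDegree := by
  rw [aeval_def, eval₂_eq]
  refine totalDegree_finsetSum_le fun d hd => ?_
  calc (algebraMap R _ (P.coeff d) * ∏ s ∈ d.support, f s ^ d s).totalDegree
      ≤ (∏ s ∈ d.support, f s ^ d s).totalDegree := by
        refine (totalDegree_mul _ _).trans ?_
        rw [algebraMap_eq, totalDegree_C, zero_add]
    _ ≤ ∑ s ∈ d.support, (f s ^ d s).totalDegree := totalDegree_finsetProd _ _
    _ ≤ ∑ s ∈ d.support, d s := Finset.sum_le_sum fun s _ =>
        (totalDegree_pow _ _).trans ((Nat.mul_le_mul_left _ (hf s)).trans_eq (mul_one _))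
    _ ≤ P.totalDegree := le_totalDegree hd

theorem isUnit_iff_totalDegree_eq_zero {k σ : Type*} [Field k] {P : MvPolynomial σ k}
    (hP : P ≠ 0) : IsUnit P ↔ P.totalDegree = 0 := by
  rw [isUnit_iff_totalDegree_of_isReduced, and_iff_right_iff_imp]
  intro h
  rw [totalDegree_eq_zero_iff_eq_C] at h
  exact IsUnit.mk0 _ fun h0 => hP (by rw [h, h0, C_0])

theorem irreducible_of_totalDegree_eq_one_of_field {k σ : Type*} [Field k] {P : MvPolynomial σ k}
    (h : P.totalDegree = 1) : Irreducible P := by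
  refine irreducible_of_totalDegree_eq_one h fun a ha => IsUnit.mk0 a ?_
  rintro rfl
  have hP : P = 0 := MvPolynomial.ext _ _ fun d => zero_dvd_iff.1 (ha d)
  rw [hP, totalDegree_zero] at h
  exact zero_ne_one h

theorem totalDegree_X_add_C {R σ : Type*} [CommSemiring R] [Nontrivial R] (i : σ) (a : R) :
    (X i + C a).totalDegree = 1 := by
  rw [totalDegree_add_eq_left_of_totalDegree_lt (by simp), totalDegree_X]

theorem eq_of_monic_of_eq_C_mul {R σ : Type*} [CommRing R] [IsDomain R] {m : MonomialOrder σ}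
    {P T : MvPolynomial σ R} (hP : m.Monic P) (hT : m.Monic T) {c : R} (h : P = C c * T) :
    P = T := by
  have hc := congrArg m.leadingCoeff h
  rw [m.leadingCoeff_mul, m.leadingCoeff_C, hP.leadingCoeff_eq_one, hT.leadingCoeff_eq_one,
    mul_one] at hc
  rw [h, ← hc, C_1, one_mul]

theorem exists_monic_irreducible_factorization {k σ : Type*} [Field k] (m : MonomialOrder σ)
    {P : MvPolynomial σ k} (hP : P ≠ 0) :
    ∃ (c : k) (L : List (MvPolynomial σ k)),
      c ≠ 0 ∧ (∀ F ∈ L, m.Monic F ∧ Irreducible F) ∧ P = C c * L.prod := by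
  induction P using WfDvdMonoid.induction_on_irreducible with
  | zero => exact absurd rfl hP
  | unit u hu =>
    obtain ⟨c, hc, rfl⟩ := MvPolynomial.isUnit_iff_eq_C_of_isReduced.1 hu
    exact ⟨c, [], hc.ne_zero, by simp, by simp⟩
  | mul A F hA hF ih =>
    obtain ⟨c, L, hc, hL, rfl⟩ := ih hA
    have hl : m.leadingCoeff F ≠ 0 := m.leadingCoeff_ne_zero_iff.2 hF.ne_zero
    have hmonic : m.Monic (C (m.leadingCoeff F)⁻¹ * F) := by
      rw [MonomialOrder.Monic, m.leadingCoeff_mul, m.leadingCoeff_C, inv_mul_cancel₀ hl]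
    have hirr : Irreducible (C (m.leadingCoeff F)⁻¹ * F) :=
      (irreducible_isUnit_mul ((IsUnit.mk0 _ (inv_ne_zero hl)).map C)).2 hF
    refine ⟨m.leadingCoeff F * c, (C (m.leadingCoeff F)⁻¹ * F) :: L, mul_ne_zero hl hc,
      List.forall_mem_cons.2 ⟨⟨hmonic, hirr⟩, hL⟩, ?_⟩
    have hF' : F = C (m.leadingCoeff F) * (C (m.leadingCoeff F)⁻¹ * F) := by
      rw [← mul_assoc, ← C_mul, mul_inv_cancel₀ hl, C_1, one_mul]
    rw [List.prod_cons, C_mul, mul_mul_mul_comm, ← hF']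

/-- The substitution `X i ↦ f i (X i)` for a family of affine automorphisms `f i : t ↦ a t + b`
of the line. -/
noncomputable def affineSubst {R σ : Type*} [CommRing R] (f : σ → R ≃ᵃ[R] R) :
    MvPolynomial σ R →ₐ[R] MvPolynomial σ R :=
  aeval fun i => C ((f i).linear 1) * X i + C (f i 0)

variable {R σ : Type*} [CommRing R]

@[simp]
theorem affineSubst_X (f : σ → R ≃ᵃ[R] R) (i : σ) :
    affineSubst f (X i) = C ((f i).linear 1) * X i + C (f i 0) :=
  aeval_X _ i

theorem affineSubst_one : affineSubst (1 : σ → R ≃ᵃ[R] R) = AlgHom.id R _ := by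
  ext i : 1
  simp [AffineEquiv.one_def]

theorem affineSubst_mul (f g : σ → R ≃ᵃ[R] R) :
    affineSubst (f * g) = (affineSubst g).comp (affineSubst f) := by
  ext i : 1
  have linear_apply (e : R ≃ᵃ[R] R) (t : R) : e.linear t = e.linear 1 * t := by
    rw [mul_comm, ← smul_eq_mul, ← map_smul, smul_eq_mul, mul_one]
  have linear_mul : ((f * g) i).linear 1 = (f i).linear 1 * (g i).linear 1 :=
    linear_apply (f i) _
  have mul_apply_zero : (f * g) i 0 = (f i).linear 1 * g i 0 + f i 0 :=
    (congrFun (f i).toAffineMap.decomp (g i 0)).trans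
      (congrArg (· + f i 0) (linear_apply (f i) (g i 0)))
  simp only [AlgHom.comp_apply, affineSubst_X, linear_mul, mul_apply_zero, map_add, map_mul,
    algHom_C, algebraMap_eq]
  ring

theorem totalDegree_affineSubst_le (f : σ → R ≃ᵃ[R] R) (P : MvPolynomial σ R) :
    (affineSubst f P).totalDegree ≤ P.totalDegree := by
  refine totalDegree_aeval_le _ (fun i => ?_) P
  refine (totalDegree_add _ _).trans (max_le ((totalDegree_mul _ _).trans ?_) ?_)
  · rw [totalDegree_C, zero_add]
    exact (totalDegree_monomial_le _ _).trans (by simp)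
  · rw [totalDegree_C]
    exact zero_le_one

end MvPolynomial

section SkewMonoidAlgebra

open SkewMonoidAlgebra

theorem coeff_mul_of_uniqueMul {k G : Type*} [Semiring k] [Monoid G] [MulSemiringAction G k]
    {f g : SkewMonoidAlgebra k G} {a b : G} (ha : a ∈ f.support) (hb : b ∈ g.support)
    (h : UniqueMul f.support g.support a b) :
    (f * g).coeff (a * b) = f.coeff a * a • g.coeff b := by
  classical
  rw [coeff_mul, sum_def', Finset.sum_eq_single_of_mem a ha, sum_def',
    Finset.sum_eq_single_of_mem b hb, if_pos rfl]
  · intro b' hb' hne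
    rw [if_neg fun e => hne (h ha hb' e).2]
  · intro a' ha' hne
    exact Finset.sum_eq_zero fun b' hb' => if_neg fun e => hne (h ha' hb' e).1

variable {k G : Type*} [Semiring k] [NoZeroDivisors k] [Group G] [MulSemiringAction G k]

theorem mul_eq_of_uniqueMul_of_mul_eq_single {f g : SkewMonoidAlgebra k G} {a b z : G} {r : k}
    (ha : a ∈ f.support) (hb : b ∈ g.support) (hu : UniqueMul f.support g.support a b)
    (h : f * g = single z r) : a * b = z := by
  have hcoeff := coeff_mul_of_uniqueMul ha hb hu
  rw [h, coeff_single] at hcoeff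
  by_contra hz
  rw [Finsupp.single_eq_of_ne hz] at hcoeff
  rcases mul_eq_zero.1 hcoeff.symm with h0 | h0
  · exact mem_support_iff.1 ha h0
  · exact mem_support_iff.1 hb ((smul_eq_zero_iff_eq a).1 h0)

theorem exists_eq_single_of_mul_eq_single [TwoUniqueProds G] {f g : SkewMonoidAlgebra k G}
    {z : G} {r : k} (hr : r ≠ 0) (h : f * g = single z r) :
    ∃ a b s t, f = single a s ∧ g = single b t := by
  have hfg : f * g ≠ 0 := fun h0 => hr (single_eq_zero.1 (h.symm.trans h0))
  have support_card_pos {u : SkewMonoidAlgebra k G} (hu : u ≠ 0) : 0 < u.support.card :=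
    Finset.card_pos.2 (Finset.nonempty_iff_ne_empty.2 fun h0 => hu (support_eq_empty.1 h0))
  have exists_eq_single {u : SkewMonoidAlgebra k G} (hu : u.support.card = 1) :
      ∃ a s, u = single a s := by
    obtain ⟨a, s, hs⟩ := Finsupp.card_support_eq_one'.1 hu
    exact ⟨a, s, coeff_injective hs.2⟩
  have hf := support_card_pos (u := f) fun h0 => hfg (by rw [h0, zero_mul])
  have hg := support_card_pos (u := g) fun h0 => hfg (by rw [h0, mul_zero])
  by_cases hc : 1 < f.support.card * g.support.card
  · obtain ⟨p₁, hp₁, p₂, hp₂, hne, hu₁, hu₂⟩ := TwoUniqueProds.uniqueMul_of_one_lt_card hc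
    rw [Finset.mem_product] at hp₁ hp₂
    have h₁ := mul_eq_of_uniqueMul_of_mul_eq_single hp₁.1 hp₁.2 hu₁ h
    have h₂ := mul_eq_of_uniqueMul_of_mul_eq_single hp₂.1 hp₂.2 hu₂ h
    have heq := hu₁ hp₂.1 hp₂.2 (h₂.trans h₁.symm)
    exact absurd (Prod.ext heq.1 heq.2).symm hne
  · obtain ⟨a, s, hs⟩ := exists_eq_single (u := f) (by nlinarith)
    obtain ⟨b, t, ht⟩ := exists_eq_single (u := g) (by nlinarith)
    exact ⟨a, b, s, t, hs, ht⟩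

end SkewMonoidAlgebra

namespace QWeylAlgebra

open MvPolynomial

variable {K : Type*} [Field K] {n : ℕ} (q : Fin n → Kˣ)

/-- The group `ℤⁿ` of multidegrees, written multiplicatively. It carries `q` because it is to act
on `K[θ_1, …, θ_n]` through the commutation rules of `Q_n`. -/
def DegreeGroup {K : Type*} [Field K] {n : ℕ} (_ : Fin n → Kˣ) : Type :=
  Multiplicative (Fin n → ℤ)

instance : CommGroup (DegreeGroup q) := inferInstanceAs (CommGroup (Multiplicative (Fin n → ℤ)))

instance : TwoUniqueProds (DegreeGroup q) :=
  inferInstanceAs (TwoUniqueProds (Multiplicative (Fin n → ℤ)))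

/-- The multidegree `z` as an element of the multiplicative group `DegreeGroup q`. -/
def toDegree : (Fin n → ℤ) ≃ DegreeGroup q := Multiplicative.ofAdd

@[simp]
theorem toDegree_zero : toDegree q 0 = 1 := rfl

@[simp]
theorem toDegree_mul_toDegree (z w : Fin n → ℤ) :
    toDegree q z * toDegree q w = toDegree q (z + w) := rfl

/-- The affine map `t ↦ q_i t + 1`, which describes how `∂_i` moves past `t = θ_i`. -/
noncomputable def step (i : Fin n) : K ≃ᵃ[K] K :=
  (LinearEquiv.smulOfUnit (q i)).toAffineEquiv.trans (AffineEquiv.constVAdd K K 1)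

/-- The multidegree `z` acts by `θ_i ↦ step q i ^ z_i (θ_i)`; thus `e_i` sends `θ_i` to
`q_i θ_i + 1` and fixes the other variables. -/
noncomputable instance : MulSemiringAction (DegreeGroup q) (MvPolynomial (Fin n) K) where
  smul z P := affineSubst (fun i => step q i ^ (toDegree q).symm z i) P
  one_smul P := by
    change affineSubst (fun i => step q i ^ (0 : ℤ)) P = P
    simp only [zpow_zero]
    exact DFunLike.congr_fun affineSubst_one P
  mul_smul z w P := by
    change affineSubst (fun i => step q i ^ ((toDegree q).symm z i + (toDegree q).symm w i)) P = _
    simp only [add_comm ((toDegree q).symm z _), zpow_add]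
    exact DFunLike.congr_fun (affineSubst_mul _ _) P
  smul_zero z := map_zero _
  smul_add z := map_add _
  smul_one z := map_one _
  smul_mul z := map_mul _

theorem toDegree_smul (z : Fin n → ℤ) (P : MvPolynomial (Fin n) K) :
    toDegree q z • P = affineSubst (fun i => step q i ^ z i) P := rfl

instance : SMulCommClass (DegreeGroup q) K (MvPolynomial (Fin n) K) where
  smul_comm z a P := map_smul (affineSubst fun i => step q i ^ (toDegree q).symm z i) a P

@[simp]
theorem degree_smul_C (z : DegreeGroup q) (a : K) : z • (C a : MvPolynomial (Fin n) K) = C a :=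
  AlgHom.commutes _ a

theorem toDegree_smul_X_of_eq_zero {z : Fin n → ℤ} {i : Fin n} (h : z i = 0) :
    toDegree q z • (X i : MvPolynomial (Fin n) K) = X i := by
  simp [toDegree_smul, h, AffineEquiv.one_def]

theorem toDegree_single_smul_X (i : Fin n) :
    toDegree q (Pi.single i 1) • (X i : MvPolynomial (Fin n) K) = C (q i : K) * X i + 1 := by
  have linear_one : (step q i).linear 1 = (q i : K) := mul_one _
  have apply_zero : step q i 0 = 1 := by simp [step]
  simp [toDegree_smul, linear_one, apply_zero]

theorem totalDegree_degree_smul (z : DegreeGroup q) (P : MvPolynomial (Fin n) K) :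
    (z • P).totalDegree = P.totalDegree := by
  refine le_antisymm (totalDegree_affineSubst_le _ _) ?_
  calc P.totalDegree = (z⁻¹ • z • P).totalDegree := by rw [inv_smul_smul]
    _ ≤ (z • P).totalDegree := totalDegree_affineSubst_le _ _

/-- The skew group algebra of `ℤⁿ` over `K[θ_1, …, θ_n]`, in which `Q_n` embeds. -/
abbrev SkewAlgebra {K : Type*} [Field K] {n : ℕ} (q : Fin n → Kˣ) : Type _ :=
  SkewMonoidAlgebra (MvPolynomial (Fin n) K) (DegreeGroup q)

/-- The homomorphism `∂_i ↦ t_i`, `x_i ↦ θ_i t_i⁻¹` to the skew group algebra, where `t_i` is the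
group element of multidegree `e_i`. -/
noncomputable def toSkew : QWeylAlgebra q →ₐ[K] SkewAlgebra q :=
  RingQuot.liftAlgHom K ⟨FreeAlgebra.lift K (Sum.elim
    (fun i => SkewMonoidAlgebra.single (toDegree q (-Pi.single i 1)) (X i))
    (fun i => SkewMonoidAlgebra.single (toDegree q (Pi.single i 1)) 1)), by
    intro a b h
    induction h with
    | x_comm i j =>
      rcases eq_or_ne i j with rfl | h
      · rfl
      · simp [h, h.symm, toDegree_smul_X_of_eq_zero, mul_comm]
    | d_comm i j => simp [add_comm]
    | d_x_ne i j h => simp [h.symm, toDegree_smul_X_of_eq_zero, add_comm]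
    | d_x i =>
      simp [toDegree_single_smul_X, ← SkewMonoidAlgebra.single_one_one, C_mul',
        SkewMonoidAlgebra.smul_single]⟩

@[simp]
theorem toSkew_x (i : Fin n) :
    toSkew q (x q i) = SkewMonoidAlgebra.single (toDegree q (-Pi.single i 1)) (X i) := by
  simp [toSkew, x]

@[simp]
theorem toSkew_d (i : Fin n) :
    toSkew q (d q i) = SkewMonoidAlgebra.single (toDegree q (Pi.single i 1)) 1 := by
  simp [toSkew, d]

/-- The evaluation `K[X_1, …, X_n] → Q_n` at `θ_1, …, θ_n`. -/
noncomputable def thetaHom : MvPolynomial (Fin n) K →ₐ[K] QWeylAlgebra q :=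
  (thetaAlgebra q).val.comp (aeval (thetaGen q))

@[simp]
theorem thetaHom_X (i : Fin n) : thetaHom q (X i) = theta q i := by
  simp [thetaHom, thetaGen]

@[simp]
theorem thetaHom_C (a : K) : thetaHom q (C a) = algebraMap K _ a :=
  AlgHom.commutes _ a

theorem range_thetaHom : (thetaHom q).range = thetaAlgebra q := by
  refine le_antisymm ?_ (Algebra.adjoin_le ?_)
  · rintro _ ⟨P, rfl⟩
    exact (aeval (thetaGen q) P : thetaAlgebra q).2
  · rintro _ ⟨i, rfl⟩
    exact ⟨X i, thetaHom_X q i⟩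

@[simp]
theorem toSkew_thetaHom (P : MvPolynomial (Fin n) K) :
    toSkew q (thetaHom q P) = SkewMonoidAlgebra.single 1 P := by
  induction P using MvPolynomial.induction_on with
  | C a => rw [thetaHom_C, AlgHom.commutes]; rfl
  | add P R hP hR => rw [map_add, map_add, hP, hR, SkewMonoidAlgebra.single_add]
  | mul_X P i hP => simp [hP, theta]

theorem thetaHom_injective : Function.Injective (thetaHom q) := fun P R h =>
  SkewMonoidAlgebra.single_injective _ <| by
    rw [← toSkew_thetaHom q P, ← toSkew_thetaHom q R, h]

/-- `K[θ_1, …, θ_n]` is a polynomial ring. -/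
noncomputable def thetaEquiv : MvPolynomial (Fin n) K ≃ₐ[K] thetaAlgebra q :=
  AlgEquiv.ofBijective (aeval (thetaGen q))
    ⟨fun _ _ h => thetaHom_injective q (congrArg Subtype.val h), fun f => by
      obtain ⟨P, hP⟩ := (range_thetaHom q).ge f.2
      exact ⟨P, Subtype.ext hP⟩⟩

@[simp]
theorem coe_thetaEquiv (P : MvPolynomial (Fin n) K) :
    (thetaEquiv q P : QWeylAlgebra q) = thetaHom q P := rfl

theorem thetaEquiv_X (i : Fin n) : thetaEquiv q (X i) = thetaGen q i :=
  aeval_X _ i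

theorem thetaEquiv_X_add_C (i : Fin n) :
    thetaEquiv q (X i + C (1 / (q i : K))) = thetaShift q i := by
  rw [map_add, thetaEquiv_X, thetaShift, ← algebraMap_eq, AlgEquiv.commutes]

/-- `∂_i` for `s = 1` and `x_i` for `s = -1`: the generator of multidegree `s e_i`. -/
noncomputable def generator (i : Fin n) (s : ℤˣ) : QWeylAlgebra q :=
  if s = 1 then d q i else x q i

@[simp]
theorem generator_one (i : Fin n) : generator q i 1 = d q i := if_pos rfl

@[simp]
theorem generator_neg_one (i : Fin n) : generator q i (-1) = x q i := if_neg (by decide)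

/-- The polynomial whose value at `θ` is `generator q i s * generator q i (-s)`, that is,
`∂_i x_i = q_i θ_i + 1` for `s = 1` and `x_i ∂_i = θ_i` for `s = -1`. -/
noncomputable def splitPoly (i : Fin n) (s : ℤˣ) : MvPolynomial (Fin n) K :=
  if s = 1 then C (q i : K) * X i + 1 else X i

@[simp]
theorem splitPoly_one (i : Fin n) : splitPoly q i 1 = C (q i : K) * X i + 1 := if_pos rfl

@[simp]
theorem splitPoly_neg_one (i : Fin n) : splitPoly q i (-1) = X i := if_neg (by decide)

theorem d_mul_x_self (i : Fin n) : d q i * x q i = (q i : K) • theta q i + 1 := by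
  simpa [x, d, theta] using RingQuot.mkAlgHom_rel K (QWeylRel.d_x (q := q) i)

theorem generator_mul_generator_neg (i : Fin n) (s : ℤˣ) :
    generator q i s * generator q i (-s) = thetaHom q (splitPoly q i s) := by
  rcases Int.units_eq_one_or s with rfl | rfl
  · simp [d_mul_x_self, Algebra.smul_def]
  · simp [theta]

theorem generator_commute {i j : Fin n} (h : i ≠ j) (s t : ℤˣ) :
    Commute (generator q i s) (generator q j t) := by
  rcases Int.units_eq_one_or s with rfl | rfl <;> rcases Int.units_eq_one_or t with rfl | rfl <;>
    simp only [generator_one, generator_neg_one]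
  · exact d_mul_d q i j
  · exact d_mul_x_of_ne q h
  · exact (d_mul_x_of_ne q h.symm).symm
  · exact x_mul_x q i j

theorem generator_commute_theta {i j : Fin n} (h : i ≠ j) (s : ℤˣ) :
    Commute (generator q i s) (theta q j) := by
  simpa [theta] using (generator_commute q h s (-1)).mul_right (generator_commute q h s 1)

theorem d_mul_thetaHom (i : Fin n) (P : MvPolynomial (Fin n) K) :
    d q i * thetaHom q P = thetaHom q (toDegree q (Pi.single i 1) • P) * d q i := by
  induction P using MvPolynomial.induction_on with
  | C a => rw [degree_smul_C, thetaHom_C, Algebra.commutes]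
  | add P R hP hR => simp only [map_add, smul_add, mul_add, add_mul, hP, hR]
  | mul_X P j hP =>
    have hX : d q i * theta q j = thetaHom q (toDegree q (Pi.single i 1) • X j) * d q i := by
      rcases eq_or_ne i j with rfl | h
      · rw [toDegree_single_smul_X, ← splitPoly_one, ← generator_mul_generator_neg]
        simp [theta, mul_assoc]
      · rw [toDegree_smul_X_of_eq_zero q (Pi.single_eq_of_ne h.symm 1), thetaHom_X]
        exact (generator_one q i ▸ generator_commute_theta q h 1).eq
    rw [map_mul, thetaHom_X, ← mul_assoc, hP, mul_assoc, hX, smul_mul', map_mul, mul_assoc]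

theorem thetaHom_mul_x (i : Fin n) (P : MvPolynomial (Fin n) K) :
    thetaHom q P * x q i = x q i * thetaHom q (toDegree q (Pi.single i 1) • P) := by
  induction P using MvPolynomial.induction_on with
  | C a => rw [degree_smul_C, thetaHom_C, Algebra.commutes]
  | add P R hP hR => simp only [map_add, smul_add, mul_add, add_mul, hP, hR]
  | mul_X P j hP =>
    have hX : theta q j * x q i = x q i * thetaHom q (toDegree q (Pi.single i 1) • X j) := by
      rcases eq_or_ne i j with rfl | h
      · rw [toDegree_single_smul_X, ← splitPoly_one, ← generator_mul_generator_neg]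
        simp [theta, mul_assoc]
      · rw [toDegree_smul_X_of_eq_zero q (Pi.single_eq_of_ne h.symm 1), thetaHom_X]
        exact (generator_neg_one q i ▸ generator_commute_theta q h (-1)).eq.symm
    rw [map_mul, thetaHom_X, mul_assoc, hX, ← mul_assoc, hP, mul_assoc, ← map_mul, ← smul_mul']

theorem generator_mul_thetaHom (i : Fin n) (s : ℤˣ) (P : MvPolynomial (Fin n) K) :
    generator q i s * thetaHom q P =
      thetaHom q (toDegree q (Pi.single i (s : ℤ)) • P) * generator q i s := by
  rcases Int.units_eq_one_or s with rfl | rfl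
  · simpa using d_mul_thetaHom q i P
  · simp [Pi.single_neg, thetaHom_mul_x, smul_smul]

/-- The power of `x_i` or `∂_i` of multidegree `k e_i`. -/
noncomputable def signedPow (i : Fin n) (k : ℤ) : QWeylAlgebra q :=
  x q i ^ (-k).toNat * d q i ^ k.toNat

@[simp]
theorem signedPow_zero (i : Fin n) : signedPow q i 0 = 1 := by
  simp [signedPow]

theorem generator_mul_signedPow (i : Fin n) {s : ℤˣ} {k : ℤ} (h : 0 ≤ s * k) :
    generator q i s * signedPow q i k = signedPow q i (k + s) := by
  rcases Int.units_eq_one_or s with rfl | rfl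
  · have hk : 0 ≤ k := by simpa using h
    have hx : (-k).toNat = 0 ∧ (-(k + 1)).toNat = 0 := by lia
    have hd : (k + 1).toNat = k.toNat + 1 := by lia
    simp only [signedPow, generator_one, Units.val_one, hx, hd, pow_zero, one_mul, pow_succ']
  · have hk : k ≤ 0 := by simpa using h
    have hd : k.toNat = 0 ∧ (k + -1).toNat = 0 := by lia
    have hx : (-(k + -1)).toNat = (-k).toNat + 1 := by lia
    simp only [signedPow, generator_neg_one, Units.val_neg, Units.val_one, hx, hd, pow_zero,
      mul_one, pow_succ']

/-- The product of powers of the `x_i` and `∂_i` that spans the part of multidegree `z` of `Q_n`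
over `K[θ_1, …, θ_n]`. -/
noncomputable def signedMonomial (z : Fin n → ℤ) : QWeylAlgebra q :=
  (List.ofFn fun i => signedPow q i (z i)).prod

@[simp]
theorem signedMonomial_zero : signedMonomial q 0 = 1 := by
  simp [signedMonomial]

theorem generator_mul_signedMonomial {i : Fin n} {s : ℤˣ} {z : Fin n → ℤ} (h : 0 ≤ s * z i) :
    generator q i s * signedMonomial q z = signedMonomial q (z + Pi.single i (s : ℤ)) := by
  have commute_of_lt (j : Fin n) (hj : j < i) :
      Commute (generator q i s) (signedPow q j (z j)) := by
    have hx := generator_commute q hj.ne' s (-1)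
    have hd := generator_commute q hj.ne' s 1
    rw [generator_neg_one] at hx
    rw [generator_one] at hd
    exact (hx.pow_right _).mul_right (hd.pow_right _)
  rw [signedMonomial, mul_prod_ofFn _ _ i commute_of_lt, generator_mul_signedPow q i h,
    signedMonomial]
  congr 2
  ext j : 1
  rcases eq_or_ne j i with rfl | hj
  · simp
  · simp [hj]

theorem signedMonomial_single (i : Fin n) (s : ℤˣ) :
    signedMonomial q (Pi.single i (s : ℤ)) = generator q i s := by
  simpa using
    (generator_mul_signedMonomial q (i := i) (s := s) (z := 0) (by simp)).symm

theorem exists_generator_mul_signedMonomial (i : Fin n) (s : ℤˣ) (z : Fin n → ℤ) :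
    ∃ R, generator q i s * signedMonomial q z =
      thetaHom q R * signedMonomial q (z + Pi.single i (s : ℤ)) := by
  by_cases h : 0 ≤ s * z i
  · exact ⟨1, by rw [generator_mul_signedMonomial q h, map_one, one_mul]⟩
  · refine ⟨splitPoly q i s, ?_⟩
    have h' : 0 ≤ ((-s : ℤˣ) : ℤ) * (z + Pi.single i (s : ℤ) : Fin n → ℤ) i := by
      rw [Units.val_neg, Pi.add_apply, Pi.single_eq_same, neg_mul, mul_add, Int.units_coe_mul_self]
      lia
    have hz : signedMonomial q z =
        generator q i (-s) * signedMonomial q (z + Pi.single i (s : ℤ)) := by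
      rw [generator_mul_signedMonomial q h', Units.val_neg, Pi.single_neg, add_neg_cancel_right]
    rw [hz, ← mul_assoc, generator_mul_generator_neg]

theorem eq_top_of_generator_mul_mem {S : Submodule K (QWeylAlgebra q)} (one_mem : 1 ∈ S)
    (mul_mem : ∀ i s, ∀ u ∈ S, generator q i s * u ∈ S) : S = ⊤ := by
  have mk_mul_mem (a : FreeAlgebra K (Fin n ⊕ Fin n)) :
      ∀ u ∈ S, RingQuot.mkAlgHom K (QWeylRel q) a * u ∈ S := by
    induction a using FreeAlgebra.induction with
    | grade0 r =>
      intro u hu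
      rw [AlgHom.commutes, ← Algebra.smul_def]
      exact S.smul_mem r hu
    | grade1 g =>
      rcases g with i | i
      · simpa [x] using mul_mem i (-1)
      · simpa [d] using mul_mem i 1
    | mul a b ha hb =>
      intro u hu
      rw [map_mul, mul_assoc]
      exact ha _ (hb u hu)
    | add a b ha hb =>
      intro u hu
      rw [map_add, add_mul]
      exact S.add_mem (ha u hu) (hb u hu)
  refine S.eq_top_iff'.2 fun u => ?_
  obtain ⟨a, rfl⟩ := RingQuot.mkAlgHom_surjective K (QWeylRel q) u
  simpa using mk_mul_mem a 1 one_mem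

/-- The sum of the homogeneous components `F_z(θ) u_z`, where `u_z = signedMonomial q z`. -/
noncomputable def ofComponents :
    ((Fin n → ℤ) →₀ MvPolynomial (Fin n) K) →ₗ[K] QWeylAlgebra q :=
  Finsupp.lsum K fun z =>
    (LinearMap.mulRight K (signedMonomial q z)).comp (thetaHom q).toLinearMap

@[simp]
theorem ofComponents_single (z : Fin n → ℤ) (P : MvPolynomial (Fin n) K) :
    ofComponents q (Finsupp.single z P) = thetaHom q P * signedMonomial q z := by
  simp [ofComponents]

theorem ofComponents_surjective : Function.Surjective (ofComponents q) := by
  refine LinearMap.range_eq_top.1 (eq_top_of_generator_mul_mem q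
    ⟨Finsupp.single 0 1, by simp⟩ ?_)
  rintro i s _ ⟨F, rfl⟩
  induction F using Finsupp.induction_linear with
  | zero => simp
  | add F G hF hG =>
    rw [map_add, mul_add]
    exact Submodule.add_mem _ hF hG
  | single z P =>
    obtain ⟨R, hR⟩ := exists_generator_mul_signedMonomial q i s z
    refine ⟨Finsupp.single (z + Pi.single i (s : ℤ)) (toDegree q (Pi.single i (s : ℤ)) • P * R), ?_⟩
    rw [ofComponents_single, ofComponents_single, ← mul_assoc, generator_mul_thetaHom, map_mul,
      mul_assoc, mul_assoc, hR]

variable {q}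

/-- `u` is nonzero and homogeneous of multidegree `z`, and `d` is its total degree in the
generators `x_i`, `∂_i`. Both degrees are read off in the skew group algebra, where the image of
`u` is `M t^z`: there `∂_i` is `t_i` and `x_i` is `θ_i t_i⁻¹`, so `d` is `2 deg M + ∑ z_i`. -/
def HasDegree (u : QWeylAlgebra q) (z : Fin n → ℤ) (d : ℤ) : Prop :=
  ∃ M : MvPolynomial (Fin n) K, M ≠ 0 ∧
    toSkew q u = SkewMonoidAlgebra.single (toDegree q z) M ∧ d = 2 * M.totalDegree + ∑ i, z i

theorem hasDegree_thetaHom {P : MvPolynomial (Fin n) K} (hP : P ≠ 0) :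
    HasDegree (thetaHom q P) 0 (2 * P.totalDegree) :=
  ⟨P, hP, by simp, by simp⟩

theorem hasDegree_one : HasDegree (1 : QWeylAlgebra q) 0 0 :=
  ⟨1, one_ne_zero, by simp, by simp⟩

theorem hasDegree_generator (i : Fin n) (s : ℤˣ) :
    HasDegree (generator q i s) (Pi.single i (s : ℤ)) 1 := by
  rcases Int.units_eq_one_or s with rfl | rfl
  · exact ⟨1, one_ne_zero, by simp, by simp⟩
  · exact ⟨X i, X_ne_zero i, by simp [Pi.single_neg], by simp⟩

theorem hasDegree_d (i : Fin n) : HasDegree (d q i) (Pi.single i 1) 1 := by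
  simpa using hasDegree_generator (q := q) i 1

theorem hasDegree_x (i : Fin n) : HasDegree (x q i) (-Pi.single i 1) 1 := by
  simpa [Pi.single_neg] using hasDegree_generator (q := q) i (-1)

namespace HasDegree

variable {u v : QWeylAlgebra q} {z w : Fin n → ℤ} {d e : ℤ}

theorem ne_zero (h : HasDegree u z d) : u ≠ 0 := by
  obtain ⟨M, hM, hu, -⟩ := h
  rintro rfl
  rw [map_zero] at hu
  exact hM (SkewMonoidAlgebra.single_eq_zero.1 hu.symm)

theorem unique (h : HasDegree u z d) (h' : HasDegree u w e) : z = w ∧ d = e := by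
  obtain ⟨M, hM, hu, rfl⟩ := h
  obtain ⟨N, -, hu', rfl⟩ := h'
  have hcoeff := congrArg SkewMonoidAlgebra.coeff (hu.symm.trans hu')
  simp only [SkewMonoidAlgebra.coeff_single] at hcoeff
  rcases (Finsupp.single_eq_single_iff _ _ _ _).1 hcoeff with ⟨hz, rfl⟩ | ⟨hM', -⟩
  · obtain rfl := (toDegree q).injective hz
    exact ⟨rfl, rfl⟩
  · exact absurd hM' hM

theorem mul (hu : HasDegree u z d) (hv : HasDegree v w e) :
    HasDegree (u * v) (z + w) (d + e) := by
  obtain ⟨M, hM, hu, rfl⟩ := hu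
  obtain ⟨N, hN, hv, rfl⟩ := hv
  have hN' : toDegree q z • N ≠ 0 := (smul_ne_zero_iff_ne _).2 hN
  refine ⟨M * toDegree q z • N, mul_ne_zero hM hN', by simp [hu, hv], ?_⟩
  rw [totalDegree_mul_of_isDomain hM hN', totalDegree_degree_smul]
  simp only [Pi.add_apply, Finset.sum_add_distrib]
  push_cast
  ring

theorem exists_of_mul (h : HasDegree (u * v) z d) :
    ∃ z₁ z₂ d₁ d₂, HasDegree u z₁ d₁ ∧ HasDegree v z₂ d₂ ∧ z₁ + z₂ = z ∧ d₁ + d₂ = d := by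
  obtain ⟨M, hM, huv, -⟩ := id h
  rw [map_mul] at huv
  obtain ⟨a, b, A, B, ha, hb⟩ := exists_eq_single_of_mul_eq_single hM huv
  obtain ⟨z₁, rfl⟩ := (toDegree q).surjective a
  obtain ⟨z₂, rfl⟩ := (toDegree q).surjective b
  have hA : A ≠ 0 := by
    rintro rfl
    rw [ha, SkewMonoidAlgebra.single_zero, zero_mul] at huv
    exact hM (SkewMonoidAlgebra.single_eq_zero.1 huv.symm)
  have hB : B ≠ 0 := by
    rintro rfl
    rw [hb, SkewMonoidAlgebra.single_zero, mul_zero] at huv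
    exact hM (SkewMonoidAlgebra.single_eq_zero.1 huv.symm)
  have hu : HasDegree u z₁ _ := ⟨A, hA, ha, rfl⟩
  have hv : HasDegree v z₂ _ := ⟨B, hB, hb, rfl⟩
  exact ⟨z₁, z₂, _, _, hu, hv, (hu.mul hv).unique h⟩

theorem smul (h : HasDegree u z d) {c : K} (hc : c ≠ 0) : HasDegree (c • u) z d := by
  have hC := (hasDegree_thetaHom (q := q) (P := C c) (by simpa using hc)).mul h
  simpa [Algebra.smul_def] using hC

theorem pow (h : HasDegree u z d) (k : ℕ) : HasDegree (u ^ k) (k • z) (k * d) := by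
  induction k with
  | zero => simpa using hasDegree_one
  | succ k ih =>
    rw [pow_succ, succ_nsmul, Nat.cast_succ, add_mul, one_mul]
    exact ih.mul h

theorem prod_ofFn {k : ℕ} {f : Fin k → QWeylAlgebra q} {z : Fin k → Fin n → ℤ} {d : Fin k → ℤ}
    (h : ∀ j, HasDegree (f j) (z j) (d j)) :
    HasDegree (List.ofFn f).prod (∑ j, z j) (∑ j, d j) := by
  induction k with
  | zero => simpa using hasDegree_one
  | succ k ih =>
    rw [List.ofFn_succ, List.prod_cons, Fin.sum_univ_succ, Fin.sum_univ_succ]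
    exact (h 0).mul (ih fun j => h j.succ)

end HasDegree

theorem hasDegree_signedPow (i : Fin n) (k : ℤ) :
    HasDegree (signedPow q i k) (Pi.single i k) |k| := by
  have hz : (-k).toNat • -Pi.single i 1 + k.toNat • Pi.single i 1 =
      (Pi.single i k : Fin n → ℤ) := by
    rw [← Pi.single_neg, ← Pi.single_smul, ← Pi.single_smul, ← Pi.single_add]
    congr 1
    simp only [nsmul_eq_mul]
    lia
  have hd : ((-k).toNat : ℤ) * 1 + (k.toNat : ℤ) * 1 = |k| := by rw [Int.abs_eq_natAbs]; lia
  rw [← hz, ← hd]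
  exact ((hasDegree_x i).pow _).mul ((hasDegree_d i).pow _)

theorem hasDegree_signedMonomial (z : Fin n → ℤ) :
    HasDegree (signedMonomial q z) z (∑ i, |z i|) := by
  simpa [Finset.univ_sum_single, signedMonomial] using
    HasDegree.prod_ofFn fun i => hasDegree_signedPow (q := q) i (z i)

theorem coeff_toSkew_ofComponents (F : (Fin n → ℤ) →₀ MvPolynomial (Fin n) K) (z : Fin n → ℤ) :
    (toSkew q (ofComponents q F)).coeff (toDegree q z) =
      F z * (toSkew q (signedMonomial q z)).coeff (toDegree q z) := by
  induction F using Finsupp.induction_linear with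
  | zero => simp
  | add F G hF hG => simp [hF, hG, add_mul]
  | single w P =>
    obtain ⟨M, -, hM, -⟩ := hasDegree_signedMonomial (q := q) w
    rcases eq_or_ne w z with rfl | h
    · simp [hM]
    · simp [hM, h, Finsupp.single_eq_of_ne ((toDegree q).injective.ne h.symm)]

namespace HasDegree

variable {u v : QWeylAlgebra q} {z : Fin n → ℤ} {d : ℤ}

theorem exists_eq (h : HasDegree u z d) : ∃ P ≠ 0,
    u = thetaHom q P * signedMonomial q z ∧ d = 2 * P.totalDegree + ∑ i, |z i| := by
  obtain ⟨F, rfl⟩ := ofComponents_surjective q u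
  have component_eq_zero (w : Fin n → ℤ) (hw : w ≠ z) : F w = 0 := by
    obtain ⟨M, -, hM, -⟩ := id h
    obtain ⟨N, hN, hN', -⟩ := hasDegree_signedMonomial (q := q) w
    have hcoeff := coeff_toSkew_ofComponents (q := q) F w
    rw [hM, hN', SkewMonoidAlgebra.coeff_single, SkewMonoidAlgebra.coeff_single,
      Finsupp.single_eq_same, Finsupp.single_eq_of_ne ((toDegree q).injective.ne hw)] at hcoeff
    exact (mul_eq_zero.1 hcoeff.symm).resolve_right hN
  have hF : F = Finsupp.single z (F z) := by
    ext1 w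
    rcases eq_or_ne w z with rfl | hw
    · simp
    · rw [component_eq_zero w hw, Finsupp.single_eq_of_ne hw]
  have hu : ofComponents q F = thetaHom q (F z) * signedMonomial q z := by
    rw [hF, ofComponents_single, Finsupp.single_eq_same]
  have hP : F z ≠ 0 := fun h0 => h.ne_zero (by rw [hu, h0, map_zero, zero_mul])
  refine ⟨F z, hP, hu, ?_⟩
  rw [hu] at h
  simpa using (h.unique ((hasDegree_thetaHom hP).mul (hasDegree_signedMonomial z))).2

theorem nonneg (h : HasDegree u z d) : 0 ≤ d := by
  obtain ⟨P, -, -, rfl⟩ := h.exists_eq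
  positivity

theorem exists_eq_thetaHom (h : HasDegree u 0 d) : ∃ P, u = thetaHom q P := by
  obtain ⟨P, -, hu, -⟩ := h.exists_eq
  exact ⟨P, by rw [hu, signedMonomial_zero, mul_one]⟩

theorem isUnit_iff (h : HasDegree u z d) : IsUnit u ↔ d = 0 := by
  constructor
  · intro hu
    obtain ⟨v, hv⟩ := hu.exists_right_inv
    obtain ⟨_, _, d₁, d₂, hu', hv', -, hd⟩ := (hv ▸ hasDegree_one).exists_of_mul
    have hd₁ := (h.unique hu').2
    have := h.nonneg
    have := hv'.nonneg
    lia
  · rintro rfl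
    obtain ⟨P, hP, rfl, hd⟩ := h.exists_eq
    have hsum : ∑ i, |z i| = 0 := by
      have : 0 ≤ ∑ i, |z i| := by positivity
      lia
    obtain rfl : z = 0 := funext fun i =>
      abs_eq_zero.1 ((Finset.sum_eq_zero_iff_of_nonneg fun i _ => abs_nonneg _).1 hsum i
        (Finset.mem_univ i))
    simpa using ((isUnit_iff_totalDegree_eq_zero hP).2 (by lia)).map (thetaHom q)

theorem irreducible (h : HasDegree u z 1) : Irreducible u := by
  refine ⟨fun hu => one_ne_zero (h.isUnit_iff.1 hu), ?_⟩
  rintro a b rfl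
  obtain ⟨_, _, d₁, d₂, ha, hb, -, hd⟩ := h.exists_of_mul
  have := ha.nonneg
  have := hb.nonneg
  rw [ha.isUnit_iff, hb.isUnit_iff]
  lia

theorem isReducible_mul {w : Fin n → ℤ} (hu : HasDegree u z 1) (hv : HasDegree v w 1) :
    IsReducible (u * v) :=
  ⟨(hu.mul hv).ne_zero, fun h => two_ne_zero ((hu.mul hv).isUnit_iff.1 h), u, v,
    hu.irreducible.not_isUnit, hv.irreducible.not_isUnit, rfl⟩

end HasDegree

theorem isUnit_thetaHom_iff {P : MvPolynomial (Fin n) K} : IsUnit (thetaHom q P) ↔ IsUnit P := by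
  refine ⟨fun h => ?_, fun h => h.map (thetaHom q)⟩
  rcases eq_or_ne P 0 with rfl | hP
  · have := (thetaHom_injective q).nontrivial
    exact absurd (map_zero (thetaHom q) ▸ h) not_isUnit_zero
  · have hd := (hasDegree_thetaHom hP).isUnit_iff.1 h
    exact (isUnit_iff_totalDegree_eq_zero hP).2 (by lia)

theorem isReducible_thetaHom_splitPoly (i : Fin n) (s : ℤˣ) :
    IsReducible (thetaHom q (splitPoly q i s)) :=
  generator_mul_generator_neg q i s ▸
    (hasDegree_generator i s).isReducible_mul (hasDegree_generator i (-s))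

theorem HasDegree.exists_mul_eq_thetaHom_mul_splitPoly {u v : QWeylAlgebra q} {z : Fin n → ℤ}
    {d e : ℤ} (hu : HasDegree u z d) (hv : HasDegree v (-z) e) (hz : z ≠ 0) :
    ∃ A i s, u * v = thetaHom q (A * splitPoly q i s) := by
  obtain ⟨i, s, hs⟩ : ∃ (i : Fin n) (s : ℤˣ), 0 < s * z i := by
    obtain ⟨i, hi⟩ := Function.ne_iff.1 hz
    rcases lt_or_gt_of_ne hi with hi | hi
    · exact ⟨i, -1, by simpa using hi⟩
    · exact ⟨i, 1, by simpa using hi⟩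
  have split_generator : signedMonomial q z =
      generator q i s * signedMonomial q (z - Pi.single i (s : ℤ)) := by
    rw [generator_mul_signedMonomial, sub_add_cancel]
    rw [Pi.sub_apply, Pi.single_eq_same, mul_sub, Int.units_coe_mul_self]
    lia
  obtain ⟨F, -, hF, -⟩ := hu.exists_eq
  obtain ⟨G, -, hG, -⟩ := ((hasDegree_signedMonomial (z - Pi.single i (s : ℤ))).mul hv).exists_eq
  rw [sub_add_eq_add_sub, add_neg_cancel, zero_sub, ← Pi.single_neg, ← Units.val_neg,
    signedMonomial_single] at hG
  refine ⟨F * toDegree q (Pi.single i (s : ℤ)) • G, i, s, ?_⟩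
  calc u * v
      = thetaHom q F * generator q i s * (signedMonomial q (z - Pi.single i (s : ℤ)) * v) := by
        rw [hF, split_generator]
        simp only [mul_assoc]
    _ = thetaHom q F * (generator q i s * thetaHom q G) * generator q i (-s) := by
        rw [hG]
        simp only [mul_assoc]
    _ = thetaHom q (F * toDegree q (Pi.single i (s : ℤ)) • G * splitPoly q i s) := by
        rw [generator_mul_thetaHom, map_mul, map_mul, ← generator_mul_generator_neg]
        simp only [mul_assoc]

theorem exists_eq_C_mul_splitPoly {P : MvPolynomial (Fin n) K} (hP : Irreducible P)
    (hred : IsReducible (thetaHom q P)) : ∃ i s c, P = C c * splitPoly q i s := by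
  obtain ⟨-, -, g, h, hg, hh, hgh⟩ := hred
  obtain ⟨z, w, _, _, hgz, hhw, hzw, -⟩ := (hgh ▸ hasDegree_thetaHom hP.ne_zero).exists_of_mul
  obtain rfl : w = -z := (neg_eq_of_add_eq_zero_right hzw).symm
  have hz : z ≠ 0 := by
    rintro rfl
    obtain ⟨G, rfl⟩ := hgz.exists_eq_thetaHom
    obtain ⟨H, rfl⟩ := (neg_zero (G := Fin n → ℤ) ▸ hhw).exists_eq_thetaHom
    rw [isUnit_thetaHom_iff] at hg hh
    rw [← map_mul] at hgh
    exact (hP.isUnit_or_isUnit (thetaHom_injective q hgh)).elim hg hh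
  obtain ⟨A, i, s, hA⟩ := hgz.exists_mul_eq_thetaHom_mul_splitPoly hhw hz
  have factor : P = A * splitPoly q i s := thetaHom_injective q (hgh.trans hA)
  have hsplit : ¬ IsUnit (splitPoly q i s) := fun hu =>
    (isReducible_thetaHom_splitPoly i s).2.1 (hu.map (thetaHom q))
  obtain ⟨c, -, hc⟩ := isUnit_iff_eq_C_of_isReduced.1
    ((hP.isUnit_or_isUnit factor).resolve_right hsplit)
  exact ⟨i, s, c, by rw [factor, hc]⟩

theorem splitPoly_one_eq_C_mul (i : Fin n) :
    splitPoly q i 1 = C (q i : K) * (X i + C (1 / (q i : K))) := by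
  rw [splitPoly_one, mul_add, ← C_mul, mul_one_div_cancel (q i).ne_zero, C_1]

theorem theta_add_eq_smul_d_mul_x (i : Fin n) :
    theta q i + algebraMap K (QWeylAlgebra q) (1 / (q i : K)) =
      (1 / (q i : K)) • (d q i * x q i) := by
  rw [d_mul_x_self, smul_add, smul_smul, one_div, inv_mul_cancel₀ (q i).ne_zero, one_smul,
    Algebra.algebraMap_eq_smul_one]

theorem monic_irreducible_isReducible_thetaHom_iff (m : MonomialOrder (Fin n))
    (P : MvPolynomial (Fin n) K) :
    m.Monic P ∧ Irreducible P ∧ IsReducible (thetaHom q P) ↔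
      ∃ i, P = X i ∨ P = X i + C (1 / (q i : K)) := by
  constructor
  · rintro ⟨hm, hP, hred⟩
    obtain ⟨i, s, c, h⟩ := exists_eq_C_mul_splitPoly hP hred
    rcases Int.units_eq_one_or s with rfl | rfl
    · rw [splitPoly_one_eq_C_mul, ← mul_assoc, ← C_mul] at h
      exact ⟨i, Or.inr (eq_of_monic_of_eq_C_mul hm (m.monic_X_add_C i _) h)⟩
    · rw [splitPoly_neg_one] at h
      exact ⟨i, Or.inl (eq_of_monic_of_eq_C_mul hm m.monic_X h)⟩
  · rintro ⟨i, rfl | rfl⟩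
    · refine ⟨m.monic_X, irreducible_of_totalDegree_eq_one_of_field (totalDegree_X i), ?_⟩
      rw [thetaHom_X]
      exact (hasDegree_x i).isReducible_mul (hasDegree_d i)
    · refine ⟨m.monic_X_add_C i _, irreducible_of_totalDegree_eq_one_of_field
        (totalDegree_X_add_C i _), ?_⟩
      rw [map_add, thetaHom_X, thetaHom_C, theta_add_eq_smul_d_mul_x, ← smul_mul_assoc]
      exact ((hasDegree_d i).smul (one_div_ne_zero (q i).ne_zero)).isReducible_mul (hasDegree_x i)

theorem isThetaMonic_thetaEquiv_iff {m : MonomialOrder (Fin n)} {P : MvPolynomial (Fin n) K} :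
    IsThetaMonic q m (thetaEquiv q P) ↔ m.Monic P :=
  ⟨fun ⟨_, hR, h⟩ => (thetaEquiv q).injective h ▸ hR, fun h => ⟨P, h, rfl⟩⟩

theorem isThetaMonic_irreducible_isReducible_iff (m : MonomialOrder (Fin n)) (f : thetaAlgebra q) :
    IsThetaMonic q m f ∧ Irreducible f ∧ IsReducible (f : QWeylAlgebra q) ↔
      ∃ i, f = thetaGen q i ∨ f = thetaShift q i := by
  obtain ⟨P, rfl⟩ := (thetaEquiv q).surjective f
  rw [isThetaMonic_thetaEquiv_iff, MulEquiv.irreducible_iff, coe_thetaEquiv,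
    monic_irreducible_isReducible_thetaHom_iff]
  simp only [← thetaEquiv_X, ← thetaEquiv_X_add_C, EmbeddingLike.apply_eq_iff_eq]

theorem gradedPart_zero_le : gradedPart q 0 ≤ Subalgebra.toSubmodule (thetaAlgebra q) := by
  refine Submodule.span_le.2 ?_
  rintro _ ⟨a, b, hab, rfl⟩
  obtain rfl : b = a := funext fun i => by simpa [sub_eq_zero] using hab i
  have h := (HasDegree.prod_ofFn fun i => (hasDegree_x (q := q) i).pow (b i)).mul
    (HasDegree.prod_ofFn fun i => (hasDegree_d (q := q) i).pow (b i))
  simp only [← Finset.sum_add_distrib, smul_neg, neg_add_cancel, Finset.sum_const_zero] at h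
  obtain ⟨P, hP⟩ := h.exists_eq_thetaHom
  exact (range_thetaHom q).le ⟨P, hP.symm⟩

theorem exists_isThetaFactorization (m : MonomialOrder (Fin n)) {p : QWeylAlgebra q}
    (hp : p ∈ thetaAlgebra q) (hp0 : p ≠ 0) : ∃ c L, IsThetaFactorization q m p c L := by
  obtain ⟨P, rfl⟩ := (range_thetaHom q).ge hp
  have hP : P ≠ 0 := by
    rintro rfl
    exact hp0 (map_zero _)
  obtain ⟨c, L, hc, hL, hPL⟩ := exists_monic_irreducible_factorization m hP
  refine ⟨c, L.map (thetaEquiv q), hc, ?_, ?_⟩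
  · intro f hf
    obtain ⟨F, hF, rfl⟩ := List.mem_map.1 hf
    exact ⟨isThetaMonic_thetaEquiv_iff.2 (hL F hF).1,
      (MulEquiv.irreducible_iff (thetaEquiv q)).2 (hL F hF).2⟩
  · rw [← map_list_prod, coe_thetaEquiv, ← map_smul, smul_eq_C_mul, ← hPL]
    rfl

theorem rewriteScalar_smul_prod_rewriteFactor (f : thetaAlgebra q) :
    rewriteScalar q f • (rewriteFactor q f).prod = (f : QWeylAlgebra q) := by
  unfold rewriteScalar rewriteFactor
  split_ifs with hgen hshift
  · conv_rhs => rw [hgen.choose_spec]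
    simp [thetaGen, theta]
  · conv_rhs => rw [hshift.choose_spec]
    simpa [thetaShift, thetaGen] using (theta_add_eq_smul_d_mul_x (q := q) hshift.choose).symm
  · simp

theorem coe_prod_eq_smul_prod_flatMap (L : List (thetaAlgebra q)) :
    ((L.prod : thetaAlgebra q) : QWeylAlgebra q) =
      (L.map (rewriteScalar q)).prod • (L.flatMap (rewriteFactor q)).prod := by
  induction L with
  | nil => simp
  | cons f L ih =>
    rw [List.prod_cons, List.map_cons, List.prod_cons, List.flatMap_cons, List.prod_append,
      ← smul_mul_smul_comm, rewriteScalar_smul_prod_rewriteFactor, ← ih]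
    rfl

theorem irreducible_coe_of_not_isReducible {f : thetaAlgebra q} (hf : Irreducible f)
    (h : ¬ IsReducible (f : QWeylAlgebra q)) : Irreducible (f : QWeylAlgebra q) := by
  obtain ⟨P, rfl⟩ := (thetaEquiv q).surjective f
  rw [MulEquiv.irreducible_iff] at hf
  rw [coe_thetaEquiv] at h ⊢
  have hu : ¬ IsUnit (thetaHom q P) := isUnit_thetaHom_iff.not.2 hf.not_isUnit
  refine ⟨hu, fun a b hab => ?_⟩
  by_contra! hc
  exact h ⟨(hasDegree_thetaHom hf.ne_zero).ne_zero, hu, a, b, hc.1, hc.2, hab⟩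

theorem irreducible_of_mem_rewriteFactor {m : MonomialOrder (Fin n)} {f : thetaAlgebra q}
    (hm : IsThetaMonic q m f) (hf : Irreducible f) {g : QWeylAlgebra q}
    (hg : g ∈ rewriteFactor q f) : Irreducible g := by
  unfold rewriteFactor at hg
  split_ifs at hg with hgen hshift
  · rcases List.mem_pair.1 hg with rfl | rfl
    exacts [(hasDegree_x _).irreducible, (hasDegree_d _).irreducible]
  · rcases List.mem_pair.1 hg with rfl | rfl
    exacts [(hasDegree_d _).irreducible, (hasDegree_x _).irreducible]
  · obtain rfl := List.mem_singleton.1 hg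
    refine irreducible_coe_of_not_isReducible hf fun hred => ?_
    obtain ⟨i, hi | hi⟩ := (isThetaMonic_irreducible_isReducible_iff m f).1 ⟨hm, hf, hred⟩
    exacts [hgen ⟨i, hi⟩, hshift ⟨i, hi⟩]

theorem IsThetaFactorization.eq_smul_prod_flatMap {m : MonomialOrder (Fin n)}
    {p : QWeylAlgebra q} {c : K} {L : List (thetaAlgebra q)} (h : IsThetaFactorization q m p c L) :
    p = (c * (L.map (rewriteScalar q)).prod) • (L.flatMap (rewriteFactor q)).prod := by
  rw [h.2.2, coe_prod_eq_smul_prod_flatMap, smul_smul]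

theorem IsThetaFactorization.irreducible_of_mem_flatMap {m : MonomialOrder (Fin n)}
    {p : QWeylAlgebra q} {c : K} {L : List (thetaAlgebra q)} (h : IsThetaFactorization q m p c L) :
    ∀ g ∈ L.flatMap (rewriteFactor q), Irreducible g := by
  intro g hg
  obtain ⟨f, hf, hgf⟩ := List.mem_flatMap.1 hg
  exact irreducible_of_mem_rewriteFactor (h.2.1 f hf).1 (h.2.1 f hf).2 hgf

theorem thetaShift_weylParam (i : Fin n) :
    thetaShift (weylParam K n) i = thetaGen (weylParam K n) i + 1 := by
  simp [thetaShift]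

theorem theta_add_one_weylParam (i : Fin n) : theta (weylParam K n) i + 1 =
    d (weylParam K n) i * x (weylParam K n) i := by
  simpa using theta_add_eq_smul_d_mul_x (q := weylParam K n) i

theorem prod_map_rewriteScalar_weylParam (L : List (thetaAlgebra (weylParam K n))) :
    (L.map (rewriteScalar (weylParam K n))).prod = 1 := by
  refine List.prod_eq_one fun c hc => ?_
  obtain ⟨f, -, rfl⟩ := List.mem_map.1 hc
  unfold rewriteScalar
  split_ifs <;> simp

end QWeylAlgebra

open QWeylAlgebra in
theorem mainTheorem1_general {K : Type*} [Field K] {n : ℕ} (q : Fin n → Kˣ)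
    (m : MonomialOrder (Fin n)) :
    ({f : thetaAlgebra q |
        IsThetaMonic q m f ∧ Irreducible f ∧ IsReducible (f : QWeylAlgebra q)} =
      {f | ∃ i, f = thetaGen q i ∨
        f = thetaGen q i + algebraMap K (thetaAlgebra q) (1 / (q i : K))}) ∧
    ({f : thetaAlgebra (weylParam K n) |
        IsThetaMonic (weylParam K n) m f ∧ Irreducible f ∧
          IsReducible (f : QWeylAlgebra (weylParam K n))} =
      {f | ∃ i, f = thetaGen (weylParam K n) i ∨ f = thetaGen (weylParam K n) i + 1}) ∧
    (∀ i, theta q i = x q i * d q i ∧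
      theta q i + algebraMap K (QWeylAlgebra q) (1 / (q i : K)) =
        (1 / (q i : K)) • (d q i * x q i)) ∧
    (∀ i, theta (weylParam K n) i = x (weylParam K n) i * d (weylParam K n) i ∧
      theta (weylParam K n) i + 1 = d (weylParam K n) i * x (weylParam K n) i) ∧
    (∀ p ∈ gradedPart q 0, p ∈ thetaAlgebra q ∧
      (p ≠ 0 → ∃ c L, IsThetaFactorization q m p c L) ∧
      (∀ c L, IsThetaFactorization q m p c L →
        p = (c * (L.map (rewriteScalar q)).prod) • (L.flatMap (rewriteFactor q)).prod ∧
        ∀ g ∈ L.flatMap (rewriteFactor q), Irreducible g)) ∧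
    (∀ p ∈ gradedPart (weylParam K n) 0, p ∈ thetaAlgebra (weylParam K n) ∧
      (p ≠ 0 → ∃ c L, IsThetaFactorization (weylParam K n) m p c L) ∧
      (∀ c L, IsThetaFactorization (weylParam K n) m p c L →
        p = c • (L.flatMap (rewriteFactor (weylParam K n))).prod ∧
        ∀ g ∈ L.flatMap (rewriteFactor (weylParam K n)), Irreducible g)) := by
  refine ⟨Set.ext fun f => isThetaMonic_irreducible_isReducible_iff m f, Set.ext fun f => ?_,
    fun i => ⟨rfl, theta_add_eq_smul_d_mul_x i⟩, fun i => ⟨rfl, theta_add_one_weylParam i⟩,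
    fun p hp => ⟨gradedPart_zero_le hp, exists_isThetaFactorization m (gradedPart_zero_le hp),
      fun c L h => ⟨h.eq_smul_prod_flatMap, h.irreducible_of_mem_flatMap⟩⟩,
    fun p hp => ⟨gradedPart_zero_le hp, exists_isThetaFactorization m (gradedPart_zero_le hp),
      fun c L h => ⟨?_, h.irreducible_of_mem_flatMap⟩⟩⟩
  · simpa only [Set.mem_ofPred_eq, thetaShift_weylParam] using
      isThetaMonic_irreducible_isReducible_iff m f
  · simpa only [prod_map_rewriteScalar_weylParam, mul_one] using h.eq_smul_prod_flatMap

open QWeylAlgebra in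
theorem mainTheorem1 {K : Type*} [Field K] [CharZero K] {n : ℕ} (q : Fin n → Kˣ)
    (m : MonomialOrder (Fin n)) :
    -- the monic irreducible elements of `K[θ]` that are reducible in `Q_n`
    ({f : thetaAlgebra q |
        IsThetaMonic q m f ∧ Irreducible f ∧ IsReducible (f : QWeylAlgebra q)} =
      {f | ∃ i, f = thetaGen q i ∨
        f = thetaGen q i + algebraMap K (thetaAlgebra q) (1 / (q i : K))}) ∧
    -- the monic irreducible elements of `K[θ]` that are reducible in `A_n`
    ({f : thetaAlgebra (weylParam K n) |
        IsThetaMonic (weylParam K n) m f ∧ Irreducible f ∧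
          IsReducible (f : QWeylAlgebra (weylParam K n))} =
      {f | ∃ i, f = thetaGen (weylParam K n) i ∨ f = thetaGen (weylParam K n) i + 1}) ∧
    -- the rewriting rules in `Q_n` and in `A_n`
    (∀ i, theta q i = x q i * d q i ∧
      theta q i + algebraMap K (QWeylAlgebra q) (1 / (q i : K)) =
        (1 / (q i : K)) • (d q i * x q i)) ∧
    (∀ i, theta (weylParam K n) i = x (weylParam K n) i * d (weylParam K n) i ∧
      theta (weylParam K n) i + 1 = d (weylParam K n) i * x (weylParam K n) i) ∧
    -- factorization of homogeneous elements of degree `0` in `Q_n`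
    (∀ p ∈ gradedPart q 0, p ∈ thetaAlgebra q ∧
      (p ≠ 0 → ∃ c L, IsThetaFactorization q m p c L) ∧
      (∀ c L, IsThetaFactorization q m p c L →
        p = (c * (L.map (rewriteScalar q)).prod) • (L.flatMap (rewriteFactor q)).prod ∧
        ∀ g ∈ L.flatMap (rewriteFactor q), Irreducible g)) ∧
    -- factorization of homogeneous elements of degree `0` in `A_n`
    (∀ p ∈ gradedPart (weylParam K n) 0, p ∈ thetaAlgebra (weylParam K n) ∧
      (p ≠ 0 → ∃ c L, IsThetaFactorization (weylParam K n) m p c L) ∧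
      (∀ c L, IsThetaFactorization (weylParam K n) m p c L →
        p = c • (L.flatMap (rewriteFactor (weylParam K n))).prod ∧
        ∀ g ∈ L.flatMap (rewriteFactor (weylParam K n)), Irreducible g)) :=
  mainTheorem1_general q m
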